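/- **Proposition 2 (Lack of Markov equivalence).** *Graphs.* A *summary graph* has a finite node set $N$, split into disjoint subsets $u$ and $v$ (either may be empty), and three kinds of edges: arrows, dashed lines and full lines. Every arrow points to a node of $u$ and starts in $u$ or in $v$, dashed lines couple nodes within $u$ only, full lines couple nodes within $v$ only, and there is no directed cycle. A *regression graph* is a summary graph without semi-directed cycles, that is, without direction-preserving cycles that contain at least one arrow and at least one undirected edge (dashed or full line); an arrow and a dashed line for the same node pair count as such a cycle. In a regression graph each node pair is thus coupled by at most one edge. A directed acyclic graph is a regression graph that has only arrows. *Paths.* A path is a sequence of nodes in which successive nodes are coupled; its inner nodes are distinct and different from the endpoints, and it is a cycle if its endpoints are equal. An inner node is a *collision node* of the path if each of its two edges on the path is a dashed line or an arrow pointing to it, and a transmitting node otherwise. A *collision path* is a path all of whose inner nodes are collision nodes. Three nodes form a *V* if the subgraph they induce has precisely two edges. A path or cycle is *chordless* if each inner node forms a V with its two neighbours on the path. (A cycle is read here as a path from a node to itself, so this condition is satisfied in particular by every cycle in at least four nodes that has no chords.) *Markov equivalence.* For disjoint $\alpha,\beta,c\subseteq N$ with $\alpha,\beta\neq\varnothing$,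 a regression graph implies $\alpha\perp\!\!\!\perp\beta\mid c$ if and only if it has no path from a node of $\alpha$ to a node of $\beta$ on which every inner collision node is in $c$ or has a descendant in $c$ and every other inner node is outside $c$. The independence structure captured by the graph is the set of all the statements $\alpha\perp\!\!\!\perp\beta\mid c$ that it implies, and two graphs in the same node set are Markov equivalent if they capture the same independence structure. *Claim.* If a regression graph contains a chordless collision path in four distinct nodes, or a chordless cycle in $n\ge 4$ nodes within $v$, then it is not Markov equivalent to any directed acyclic graph in the same node set. -/

import Mathlib

/-- A summary graph on the node set `N`. The node set is split into `u` (the complement of `v`)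
and `v`. There are three kinds of edges: arrows (`arrow k i` is the arrow that starts at `k` and
points to `i`), dashed lines and full lines. Within `u` there is a mixture of a directed acyclic
graph and of a covariance graph (dashed lines), within `v` a concentration graph (full lines), and
between `u` and `v` there are only arrows that point from `v` to `u`. -/
structure SummaryGraph (N : Type*) where
  /-- the nodes of the concentration graph -/
  v : Set N
  /-- `arrow k i`: there is an arrow from the parent `k` to the offspring `i` -/
  arrow : N → N → Prop
  /-- the dashed lines -/
  dashed : SimpleGraph N
  /-- the full lines -/
  full : SimpleGraph N
  /-- every arrow points to a node of `u`; it may start in `u` or in `v` -/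
  arrow_to : ∀ {k i : N}, arrow k i → i ∉ v
  dashed_within : ∀ {i k : N}, dashed.Adj i k → i ∉ v ∧ k ∉ v
  full_within : ∀ {i k : N}, full.Adj i k → i ∈ v ∧ k ∈ v
  /-- there is no directed cycle -/
  acyclic : ∀ i : N, ¬ Relation.TransGen arrow i i

namespace SummaryGraph

variable {N : Type*} (G : SummaryGraph N)

/-- An undirected edge: a dashed or a full line. -/
def Undirected (i k : N) : Prop := G.dashed.Adj i k ∨ G.full.Adj i k

/-- One step along an edge that is not an arrow traversed against its direction. -/
def DirectionPreservingStep (i k : N) : Prop := G.arrow i k ∨ G.Undirected i k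

/-- The graph contains a semi-directed cycle: a direction-preserving cycle with at least one arrow
(here from `a` to `b`) and at least one undirected edge (here between `c` and `d`). Since directed
cycles are excluded, it makes no difference whether nodes may be repeated. A double edge, consisting
of an arrow and a dashed line for the same node pair, is the case `c = b`, `d = a`. -/
def HasSemiDirectedCycle : Prop :=
  ∃ a b c d : N, G.arrow a b ∧ Relation.ReflTransGen G.DirectionPreservingStep b c ∧
    G.Undirected c d ∧ Relation.ReflTransGen G.DirectionPreservingStep d a

end SummaryGraph

/-- A regression graph: a summary graph without semi-directed cycles. -/
structure RegressionGraph (N : Type*) extends SummaryGraph N where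
  no_semiDirectedCycle : ¬ toSummaryGraph.HasSemiDirectedCycle

/-- A directed acyclic graph on the node set `N`. -/
structure DirectedAcyclicGraph (N : Type*) where
  arrow : N → N → Prop
  acyclic : ∀ i : N, ¬ Relation.TransGen arrow i i

/-- A directed acyclic graph as a regression graph that has arrows only. -/
def DirectedAcyclicGraph.toRegressionGraph {N : Type*} (D : DirectedAcyclicGraph N) :
    RegressionGraph N where
  v := ∅
  arrow := D.arrow
  dashed := ⊥
  full := ⊥
  arrow_to := fun _ => Set.notMem_empty _
  dashed_within := fun h => h.elim
  full_within := fun h => h.elim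
  acyclic := D.acyclic
  no_semiDirectedCycle := by
    rintro ⟨a, b, c, d, -, -, h | h, -⟩ <;> exact h.elim

namespace RegressionGraph

variable {N : Type*} (G : RegressionGraph N)

/-- The nodes `i` and `k` are coupled by an edge (of any kind and in any direction). -/
def Coupled (i k : N) : Prop :=
  G.arrow i k ∨ G.arrow k i ∨ G.dashed.Adj i k ∨ G.full.Adj i k

/-- A node pair is coupled by at most one edge. -/
theorem at_most_one_edge (i k : N) :
    ¬ (G.arrow i k ∧ G.arrow k i) ∧ ¬ (G.arrow i k ∧ G.dashed.Adj i k) ∧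
      ¬ (G.arrow i k ∧ G.full.Adj i k) ∧ ¬ (G.dashed.Adj i k ∧ G.full.Adj i k) := by
  refine ⟨fun h => G.acyclic i (.tail (.single h.1) h.2), fun h => ?_,
    fun h => G.arrow_to h.1 (G.full_within h.2).2,
    fun h => (G.dashed_within h.1).1 (G.full_within h.2).1⟩
  exact G.no_semiDirectedCycle ⟨i, k, k, i, h.1, .refl, .inl h.2.symm, .refl⟩

/-- In the two-edge path with nodes `i`, `j`, `k`, the inner node `j` is a collision node: each of
the two edges is an arrow that points to `j` or a dashed line. Otherwise `j` is a transmitting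
node. -/
def IsCollision (i j k : N) : Prop :=
  (G.arrow i j ∨ G.dashed.Adj i j) ∧ (G.arrow k j ∨ G.dashed.Adj k j)

/-- The nodes `x 0, x 1, …, x n` are the successive nodes of a path with `n ≥ 1` edges. The inner
nodes `x 1, …, x (n - 1)` are distinct and differ from the endpoints `x 0` and `x n`. The endpoints
may be equal; the path is then a cycle. Since no node pair is coupled by more than one edge, a path
is determined by its nodes. -/
structure IsPath (n : ℕ) (x : ℕ → N) : Prop where
  pos : 0 < n
  coupled : ∀ t < n, G.Coupled (x t) (x (t + 1))
  distinct : ∀ s t, s < t → t ≤ n → x s = x t → s = 0 ∧ t = n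

/-- A cycle in `n` distinct nodes: a path whose endpoints `x 0` and `x n` coincide. -/
def IsCycle (n : ℕ) (x : ℕ → N) : Prop := G.IsPath n x ∧ x 0 = x n

/-- The nodes `i`, `j`, `k` form a `V` with inner node `j`: the subgraph induced by these three
nodes has precisely the two edges that couple `j` with `i` and with `k`. -/
def IsV (i j k : N) : Prop :=
  i ≠ k ∧ G.Coupled i j ∧ G.Coupled j k ∧ ¬ G.Coupled i k

/-- A path is chordless if each inner node forms a `V` with its two neighbours on the path. A cycle
without any chords satisfies this whichever of its nodes is taken as its endpoint. -/
def Chordless (n : ℕ) (x : ℕ → N) : Prop :=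
  ∀ t, t + 1 < n → G.IsV (x t) (x (t + 1)) (x (t + 2))

/-- A collision path: all inner nodes are collision nodes. -/
def IsCollisionPath (n : ℕ) (x : ℕ → N) : Prop :=
  G.IsPath n x ∧ ∀ t, t + 1 < n → G.IsCollision (x t) (x (t + 1)) (x (t + 2))

/-- The graph contains a chordless collision path in four distinct nodes. -/
def HasChordlessCollisionPathInFourNodes : Prop :=
  ∃ x : ℕ → N, G.IsCollisionPath 3 x ∧ x 0 ≠ x 3 ∧ G.Chordless 3 x

/-- The graph contains a chordless cycle in `n` nodes within `v`. -/
def HasChordlessCycleWithin (n : ℕ) : Prop :=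
  ∃ x : ℕ → N, G.IsCycle n x ∧ (∀ t ≤ n, x t ∈ G.v) ∧ G.Chordless n x

/-- The path is active given `c`: every inner collision node is in `c` or has a descendant in `c`,
and every other inner node is outside `c`. -/
def IsActive (c : Set N) (n : ℕ) (x : ℕ → N) : Prop :=
  ∀ t, t + 1 < n →
    (G.IsCollision (x t) (x (t + 1)) (x (t + 2)) →
      ∃ d ∈ c, Relation.ReflTransGen G.arrow (x (t + 1)) d) ∧
    (¬ G.IsCollision (x t) (x (t + 1)) (x (t + 2)) → x (t + 1) ∉ c)

/-- The graph implies that `α` is independent of `β` given `c` (global Markov property): no path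
between `α` and `β` is active given `c`. -/
def Implies (α β c : Set N) : Prop :=
  ¬ ∃ (n : ℕ) (x : ℕ → N), G.IsPath n x ∧ x 0 ∈ α ∧ x n ∈ β ∧ G.IsActive c n x

/-- The independence structure captured by the graph: all statements `(α, β, c)`, read as
`α` is independent of `β` given `c`, that the graph implies. Here `α`, `β`, `c` are disjoint and
`α` and `β` are not empty. -/
def independenceStructure : Set (Set N × Set N × Set N) :=
  {s | s.1.Nonempty ∧ s.2.1.Nonempty ∧ Disjoint s.1 s.2.1 ∧ Disjoint s.1 s.2.2 ∧
    Disjoint s.2.1 s.2.2 ∧ G.Implies s.1 s.2.1 s.2.2}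

/-- Two graphs in the same node set are Markov equivalent if they capture the same independence
structure. -/
def MarkovEquivalent (G H : RegressionGraph N) : Prop :=
  G.independenceStructure = H.independenceStructure

end RegressionGraph

namespace RegressionGraph

variable {N : Type*} (G : RegressionGraph N)

/-! The independence structure determines two features of a regression graph: which pairs are
coupled, and which `V`s have a collision node in the middle. Both rest on `implies_separator`: an
uncoupled pair is independent given the remaining nodes from which arrows and full lines lead to one
of the two. An active path would have only collision inner nodes, and its first one would close a
directed or semi-directed cycle.

An equivalent acyclic graph inherits both features. A chordless collision path in four nodes would
force arrows in both directions between its two inner nodes. In a cycle within `v` no node is a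
collision node, so in the acyclic graph two parents of a common offspring on the cycle must be
coupled. By `not_coupled_of_chordless` this leaves no way to orient the cycle. -/

theorem Coupled.symm {G : RegressionGraph N} {i k : N} (h : G.Coupled i k) : G.Coupled k i := by
  rcases h with h | h | h | h
  · exact .inr (.inl h)
  · exact .inl h
  · exact .inr (.inr (.inl h.symm))
  · exact .inr (.inr (.inr h.symm))

theorem Coupled.ne {G : RegressionGraph N} {i k : N} (h : G.Coupled i k) : i ≠ k := by
  rintro rfl
  rcases h with h | h | h | h
  · exact G.acyclic i (.single h)
  · exact G.acyclic i (.single h)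
  · exact h.ne rfl
  · exact h.ne rfl

/-- A sequence of direction-preserving steps has only arrows or contains an undirected edge. -/
theorem reflTransGen_arrow_or_undirected {a b : N}
    (h : Relation.ReflTransGen G.DirectionPreservingStep a b) :
    Relation.ReflTransGen G.arrow a b ∨
      ∃ c d, Relation.ReflTransGen G.DirectionPreservingStep a c ∧ G.Undirected c d ∧
        Relation.ReflTransGen G.DirectionPreservingStep d b := by
  induction h with
  | refl => exact .inl .refl
  | tail hab hbc ih =>
    rcases ih with ih | ⟨c, d, h₁, h₂, h₃⟩
    · rcases hbc with hbc | hbc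
      · exact .inl (ih.tail hbc)
      · exact .inr ⟨_, _, hab, hbc, .refl⟩
    · exact .inr ⟨c, d, h₁, h₂, h₃.tail hbc⟩

/-- The offspring of an arrow does not lead back to the parent. -/
theorem not_reflTransGen_of_arrow {a b : N} (hab : G.arrow a b) :
    ¬ Relation.ReflTransGen G.DirectionPreservingStep b a := by
  intro h
  rcases G.reflTransGen_arrow_or_undirected h with h | ⟨c, d, h₁, h₂, h₃⟩
  · exact G.acyclic a (.head' hab h)
  · exact G.no_semiDirectedCycle ⟨a, b, c, d, hab, h₁, h₂, h₃⟩

/-! ### Separation of uncoupled nodes by their anterior nodes -/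

/-- A step along an arrow or a full line. -/
def AnteriorStep (i k : N) : Prop := G.arrow i k ∨ G.full.Adj i k

/-- The node `a` is anterior to `i` or to `k`. -/
def IsAnterior (i k a : N) : Prop :=
  Relation.ReflTransGen G.AnteriorStep a i ∨ Relation.ReflTransGen G.AnteriorStep a k

theorem IsAnterior.head {G : RegressionGraph N} {i k a b : N} (hb : G.IsAnterior i k b)
    (hab : G.AnteriorStep a b) : G.IsAnterior i k a :=
  hb.imp (fun h => h.head hab) (fun h => h.head hab)

/-- From a node of `u`, anterior steps follow arrows only. -/
theorem reflTransGen_arrow_of_anteriorStep {a b : N} (ha : a ∉ G.v)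
    (h : Relation.ReflTransGen G.AnteriorStep a b) :
    b ∉ G.v ∧ Relation.ReflTransGen G.arrow a b := by
  induction h with
  | refl => exact ⟨ha, .refl⟩
  | tail _ hbc ih =>
    rcases hbc with hbc | hbc
    · exact ⟨G.arrow_to hbc, ih.2.tail hbc⟩
    · exact absurd (G.full_within hbc).1 ih.1

/-- A proper ancestor of `b` is not reached from `b` by direction-preserving steps. -/
theorem eq_of_anteriorStep_of_reflTransGen {a b : N} (ha : a ∉ G.v)
    (hab : Relation.ReflTransGen G.AnteriorStep a b)
    (hba : Relation.ReflTransGen G.DirectionPreservingStep b a) : a = b := by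
  rcases (G.reflTransGen_arrow_of_anteriorStep ha hab).2.cases_head with h | ⟨c, hac, hcb⟩
  · exact h
  · exact absurd ((Relation.ReflTransGen.mono (fun _ _ h => Or.inl h) _ _ hcb).trans hba)
      (G.not_reflTransGen_of_arrow hac)

/-- The set of the nodes other than `i` and `k` that are anterior to `i` or to `k`. -/
def separator (i k : N) : Set N := {a | a ≠ i ∧ a ≠ k ∧ G.IsAnterior i k a}

theorem isAnterior_of_collision {i k a : N}
    (h : ∃ d ∈ G.separator i k, Relation.ReflTransGen G.arrow a d) : G.IsAnterior i k a := by
  obtain ⟨d, hd, had⟩ := h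
  have had' : Relation.ReflTransGen G.AnteriorStep a d :=
    Relation.ReflTransGen.mono (fun _ _ h => Or.inl h) _ _ had
  exact hd.2.2.imp had'.trans had'.trans

/-- After an anterior step, a path leaves a transmitting node by an anterior step. -/
theorem anteriorStep_of_not_isCollision {a b c : N} (hab : G.AnteriorStep a b)
    (hbc : G.Coupled b c) (h : ¬ G.IsCollision a b c) : G.AnteriorStep b c := by
  rcases hbc with hbc | hbc | hbc | hbc
  · exact .inl hbc
  · rcases hab with hab | hab
    · exact absurd ⟨.inl hab, .inl hbc⟩ h
    · exact absurd (G.full_within hab).2 (G.arrow_to hbc)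
  · rcases hab with hab | hab
    · exact absurd ⟨.inl hab, .inr hbc.symm⟩ h
    · exact absurd (G.full_within hab).2 (G.dashed_within hbc).1
  · exact .inr hbc

theorem IsCollision.symm {G : RegressionGraph N} {a b c : N} (h : G.IsCollision a b c) :
    G.IsCollision c b a := ⟨h.2, h.1⟩

/-- Anterior steps continue along the path until they reach `k` or a collision node; the latter
leads into the separator because the path is active. The induction is on the number `m` of edges
left after the step. -/
theorem isAnterior_of_forward_step {i k : N} {n : ℕ} {x : ℕ → N} (hx : G.IsPath n x)
    (hn : x n = k) (hact : G.IsActive (G.separator i k) n x) (m : ℕ) :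
    ∀ t, t + 1 + m = n → G.AnteriorStep (x t) (x (t + 1)) → G.IsAnterior i k (x t) := by
  induction m with
  | zero =>
    intro t ht hs
    obtain rfl : t + 1 = n := ht
    exact .inr (.single (hn ▸ hs))
  | succ m ih =>
    intro t ht hs
    by_cases hc : G.IsCollision (x t) (x (t + 1)) (x (t + 2))
    · exact (G.isAnterior_of_collision ((hact t (by omega)).1 hc)).head hs
    · exact (ih (t + 1) (by omega) (G.anteriorStep_of_not_isCollision hs
        (hx.coupled (t + 1) (by omega)) hc)).head hs

theorem isAnterior_of_backward_step {i k : N} {n : ℕ} {x : ℕ → N} (hx : G.IsPath n x)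
    (h0 : x 0 = i) (hact : G.IsActive (G.separator i k) n x) (t : ℕ) (ht : t < n)
    (hs : G.AnteriorStep (x (t + 1)) (x t)) : G.IsAnterior i k (x (t + 1)) := by
  induction t with
  | zero => exact .inl (.single (h0 ▸ hs))
  | succ t ih =>
    by_cases hc : G.IsCollision (x t) (x (t + 1)) (x (t + 2))
    · exact (G.isAnterior_of_collision ((hact t ht).1 hc)).head hs
    · exact (ih (by omega) (G.anteriorStep_of_not_isCollision hs
        (hx.coupled t (by omega)).symm fun h => hc h.symm)).head hs

/-- On a path that is active given the separator, every inner node is anterior to an endpoint. -/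
theorem isAnterior_of_isActive {i k : N} {n : ℕ} {x : ℕ → N} (hx : G.IsPath n x)
    (h0 : x 0 = i) (hn : x n = k) (hact : G.IsActive (G.separator i k) n x) (t : ℕ)
    (ht : t + 1 < n) : G.IsAnterior i k (x (t + 1)) := by
  by_cases hc : G.IsCollision (x t) (x (t + 1)) (x (t + 2))
  · exact G.isAnterior_of_collision ((hact t ht).1 hc)
  · by_cases h₁ : G.AnteriorStep (x (t + 1)) (x t)
    · exact G.isAnterior_of_backward_step hx h0 hact t (by omega) h₁
    by_cases h₂ : G.AnteriorStep (x (t + 1)) (x (t + 2))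
    · exact G.isAnterior_of_forward_step hx hn hact (n - (t + 2)) (t + 1) (by omega) h₂
    -- With no anterior step out of the node, each of its two edges is dashed or an arrow pointing
    -- to it.
    refine absurd ⟨?_, ?_⟩ hc
    · rcases hx.coupled t (by omega) with h | h | h | h
      · exact .inl h
      · exact absurd (.inl h) h₁
      · exact .inr h
      · exact absurd (.inr h.symm) h₁
    · rcases hx.coupled (t + 1) ht with h | h | h | h
      · exact absurd (.inl h) h₂
      · exact .inl h
      · exact .inr h.symm
      · exact absurd (.inr h) h₂

/-- A path that is active given the separator is a collision path. -/
theorem isCollisionPath_of_isActive {i k : N} {n : ℕ} {x : ℕ → N} (hx : G.IsPath n x)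
    (h0 : x 0 = i) (hn : x n = k) (hact : G.IsActive (G.separator i k) n x) :
    G.IsCollisionPath n x := by
  refine ⟨hx, fun t ht => ?_⟩
  by_contra hc
  -- A transmitting node must avoid the separator, but an inner node is anterior and differs from
  -- both endpoints, hence lies in it.
  refine (hact t ht).2 hc ⟨fun h => ?_, fun h => ?_, G.isAnterior_of_isActive hx h0 hn hact t ht⟩
  · have := hx.distinct 0 (t + 1) (by omega) (by omega) (h0.trans h.symm)
    omega
  · have := hx.distinct (t + 1) n ht le_rfl (h.trans hn.symm)
    omega

/-- Two successive collision nodes are coupled by a dashed line. -/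
theorem IsCollision.dashed {G : RegressionGraph N} {a b c d : N} (h₁ : G.IsCollision a b c)
    (h₂ : G.IsCollision b c d) : G.dashed.Adj b c := by
  rcases h₁.2 with h | h
  · rcases h₂.1 with h' | h'
    · exact absurd ⟨h, h'⟩ (G.at_most_one_edge c b).1
    · exact h'
  · exact h.symm

/-- The inner nodes of a collision path are connected by dashed lines. -/
theorem IsCollisionPath.reflTransGen_dashed {G : RegressionGraph N} {n : ℕ} {x : ℕ → N}
    (hx : G.IsCollisionPath n x) (t : ℕ) (ht : t + 1 < n) :
    Relation.ReflTransGen G.dashed.Adj (x 1) (x (t + 1)) := by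
  induction t with
  | zero => exact .refl
  | succ t ih =>
    exact (ih (by omega)).tail ((hx.2 t (by omega)).dashed (hx.2 (t + 1) ht))

/-- Two distinct nodes that are not coupled are independent given the other nodes that are anterior
to one of them. -/
theorem implies_separator {i k : N} (hik : i ≠ k) (h : ¬ G.Coupled i k) :
    G.Implies {i} {k} (G.separator i k) := by
  rintro ⟨n, x, hx, h0, hn, hact⟩
  rw [Set.mem_singleton_iff] at h0 hn
  have hcol := G.isCollisionPath_of_isActive hx h0 hn hact
  obtain _ | _ | n := n
  · exact hik (h0.symm.trans hn)
  · exact h (by simpa [h0, hn] using hx.coupled 0 one_pos)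
  have step {a b : N} (hab : G.arrow a b ∨ G.dashed.Adj a b) :
      Relation.ReflTransGen G.DirectionPreservingStep a b :=
    .single (hab.imp id .inl)
  have hi : Relation.ReflTransGen G.DirectionPreservingStep i (x 1) :=
    h0 ▸ step (hcol.2 0 (by omega)).1
  have hk : Relation.ReflTransGen G.DirectionPreservingStep k (x (n + 1)) :=
    hn ▸ step (hcol.2 n (by omega)).2
  have hd : Relation.ReflTransGen G.DirectionPreservingStep (x (n + 1)) (x 1) :=
    Relation.ReflTransGen.mono (fun _ _ h => .inr (.inl h.symm)) _ _
      (hcol.reflTransGen_dashed n (by omega)).swap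
  have hu : x 1 ∉ G.v := by
    rcases (hcol.2 0 (by omega)).1 with h | h
    · exact G.arrow_to h
    · exact (G.dashed_within h).2
  -- Both endpoints lead to `x 1` by direction-preserving steps, `k` by way of the dashed lines. As
  -- `x 1` is in `u` and is anterior to one of them, it would equal that endpoint.
  rcases G.isAnterior_of_isActive hx h0 hn hact 0 (by omega) with ha | ha
  · have := hx.distinct 0 1 one_pos (by omega)
      (h0.trans (G.eq_of_anteriorStep_of_reflTransGen hu ha hi).symm)
    omega
  · have := hx.distinct 1 (n + 2) (by omega) le_rfl
      ((G.eq_of_anteriorStep_of_reflTransGen hu ha (hk.trans hd)).trans hn.symm)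
    omega

/-! ### Invariants of Markov equivalence: skeleton and collision `V`s -/

theorem not_implies_of_coupled {i k : N} (h : G.Coupled i k) (c : Set N) :
    ¬ G.Implies {i} {k} c := by
  refine not_not_intro ⟨1, fun t => if t = 0 then i else k, ⟨one_pos, ?_, ?_⟩, rfl, rfl, ?_⟩
  · intro t ht
    obtain rfl : t = 0 := by omega
    exact h
  · intro s t hst ht _
    omega
  · intro t ht
    omega

/-- If the outer nodes of a `V` are independent given `c`, then its inner node is a collision node
if and only if it is outside `c`. -/
theorem IsV.isCollision_iff {G : RegressionGraph N} {i j k : N} (hV : G.IsV i j k) {c : Set N}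
    (hc : G.Implies {i} {k} c) : G.IsCollision i j k ↔ j ∉ c := by
  -- Otherwise the two-edge path through `j` is active, with `j` as its own descendant in `c` if it
  -- is a collision node.
  have key : ¬ ((G.IsCollision i j k → j ∈ c) ∧ (¬ G.IsCollision i j k → j ∉ c)) := by
    rintro ⟨h₁, h₂⟩
    obtain ⟨hik, hij, hjk, -⟩ := hV
    refine hc ⟨2, fun t => if t = 0 then i else if t = 1 then j else k,
      ⟨two_pos, ?_, ?_⟩, rfl, rfl, ?_⟩
    · intro t ht
      obtain rfl | rfl : t = 0 ∨ t = 1 := by omega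
      · exact hij
      · exact hjk
    · intro s t hst ht h
      obtain ⟨rfl, rfl⟩ | ⟨rfl, rfl⟩ | ⟨rfl, rfl⟩ :
        (s = 0 ∧ t = 1) ∨ (s = 0 ∧ t = 2) ∨ (s = 1 ∧ t = 2) := by omega
      · exact absurd h hij.ne
      · exact ⟨rfl, rfl⟩
      · exact absurd h hjk.ne
    · intro t ht
      obtain rfl : t = 0 := by omega
      exact ⟨fun h => ⟨j, h₁ h, .refl⟩, h₂⟩
  tauto

theorem separator_mem_independenceStructure {i k : N} (hik : i ≠ k) (h : ¬ G.Coupled i k) :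
    (({i}, {k}, G.separator i k) : Set N × Set N × Set N) ∈ G.independenceStructure :=
  ⟨Set.singleton_nonempty i, Set.singleton_nonempty k, Set.disjoint_singleton.2 hik,
    Set.disjoint_singleton_left.2 fun h => h.1 rfl,
    Set.disjoint_singleton_left.2 fun h => h.2.1 rfl, G.implies_separator hik h⟩

namespace MarkovEquivalent

variable {G} {H : RegressionGraph N}

theorem symm (h : G.MarkovEquivalent H) : H.MarkovEquivalent G := Eq.symm h

theorem implies_separator (h : G.MarkovEquivalent H) {i k : N} (hik : i ≠ k)
    (hc : ¬ G.Coupled i k) : H.Implies {i} {k} (G.separator i k) := by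
  have hs := G.separator_mem_independenceStructure hik hc
  rw [show G.independenceStructure = H.independenceStructure from h] at hs
  exact hs.2.2.2.2.2

theorem coupled (h : G.MarkovEquivalent H) {i k : N} (hc : H.Coupled i k) : G.Coupled i k := by
  by_contra hn
  exact H.not_implies_of_coupled hc _ (h.implies_separator hc.ne hn)

/-- Markov equivalent regression graphs have the same skeleton. -/
theorem coupled_iff (h : G.MarkovEquivalent H) {i k : N} : G.Coupled i k ↔ H.Coupled i k :=
  ⟨h.symm.coupled, h.coupled⟩

theorem isV (h : G.MarkovEquivalent H) {i j k : N} (hV : G.IsV i j k) : H.IsV i j k :=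
  ⟨hV.1, h.coupled_iff.1 hV.2.1, h.coupled_iff.1 hV.2.2.1, fun hc => hV.2.2.2 (h.coupled hc)⟩

/-- Markov equivalent regression graphs have the same collision `V`s. -/
theorem isCollision_iff (h : G.MarkovEquivalent H) {i j k : N} (hV : G.IsV i j k) :
    G.IsCollision i j k ↔ H.IsCollision i j k :=
  -- The separator of `G` serves in both graphs, so membership of `j` in this one set decides the
  -- type of `j` in each.
  (hV.isCollision_iff (G.implies_separator hV.1 hV.2.2.2)).trans
    ((h.isV hV).isCollision_iff (h.implies_separator hV.1 hV.2.2.2)).symm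

end MarkovEquivalent

end RegressionGraph

/-! ### Chords in directed acyclic graphs -/

namespace DirectedAcyclicGraph

variable {N : Type*} (D : DirectedAcyclicGraph N)

theorem coupled_iff {i k : N} :
    D.toRegressionGraph.Coupled i k ↔ D.arrow i k ∨ D.arrow k i := by
  simp [RegressionGraph.Coupled, toRegressionGraph]

theorem isCollision_iff {i j k : N} :
    D.toRegressionGraph.IsCollision i j k ↔ D.arrow i j ∧ D.arrow k j := by
  simp [RegressionGraph.IsCollision, toRegressionGraph]

/-- A path without collision nodes that starts with an arrow in its direction is directed. -/
theorem transGen_of_forward {n : ℕ} {x : ℕ → N}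
    (hcpl : ∀ t < n, D.arrow (x t) (x (t + 1)) ∨ D.arrow (x (t + 1)) (x t))
    (hcol : ∀ t, t + 1 < n → ¬ (D.arrow (x t) (x (t + 1)) ∧ D.arrow (x (t + 2)) (x (t + 1))))
    {i : ℕ} (h : D.arrow (x i) (x (i + 1))) (m : ℕ) (hm : i + m + 1 ≤ n) :
    D.arrow (x (i + m)) (x (i + m + 1)) ∧
      Relation.TransGen D.arrow (x i) (x (i + m + 1)) := by
  induction m with
  | zero => exact ⟨h, .single h⟩
  | succ m ih =>
    obtain ⟨h₁, h₂⟩ := ih (by omega)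
    have h₃ := (hcpl (i + m + 1) (by omega)).resolve_right
      fun h => hcol (i + m) (by omega) ⟨h₁, h⟩
    exact ⟨h₃, h₂.tail h₃⟩

/-- A path without collision nodes that ends with an arrow against its direction is directed. -/
theorem transGen_of_backward {n : ℕ} {x : ℕ → N}
    (hcpl : ∀ t < n, D.arrow (x t) (x (t + 1)) ∨ D.arrow (x (t + 1)) (x t))
    (hcol : ∀ t, t + 1 < n → ¬ (D.arrow (x t) (x (t + 1)) ∧ D.arrow (x (t + 2)) (x (t + 1))))
    {i : ℕ} (m : ℕ) (hm : i + m + 1 ≤ n) (h : D.arrow (x (i + m + 1)) (x (i + m))) :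
    Relation.TransGen D.arrow (x (i + m + 1)) (x i) := by
  induction m with
  | zero => exact .single h
  | succ m ih =>
    have h₁ : D.arrow (x (i + m + 1)) (x (i + m)) := (hcpl (i + m) (by omega)).resolve_left
      fun h' => hcol (i + m) (by omega) ⟨h', h⟩
    exact .head h (ih (by omega) h₁)

/-- If, among the nodes of a path in a directed acyclic graph, any two parents of a common offspring
are coupled, and nodes at distance two on the path are not coupled, then no two nodes at a greater
distance are coupled, except possibly the endpoints. -/
theorem not_coupled_of_chordless {n : ℕ} {x : ℕ → N}
    (hinj : ∀ s t, s < t → t ≤ n → x s = x t → s = 0 ∧ t = n)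
    (hcpl : ∀ t < n, D.arrow (x t) (x (t + 1)) ∨ D.arrow (x (t + 1)) (x t))
    (hne : ∀ t, t + 1 < n → x t ≠ x (t + 2))
    (hchord : ∀ t, t + 1 < n → ¬ (D.arrow (x t) (x (t + 2)) ∨ D.arrow (x (t + 2)) (x t)))
    (hcol : ∀ r s t, r ≤ n → s ≤ n → t ≤ n → x r ≠ x t → D.arrow (x r) (x s) →
      D.arrow (x t) (x s) → D.arrow (x r) (x t) ∨ D.arrow (x t) (x r)) (m : ℕ) :
    ∀ i, i + m + 2 ≤ n → ¬ (i = 0 ∧ i + m + 2 = n) →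
      ¬ (D.arrow (x i) (x (i + m + 2)) ∨ D.arrow (x (i + m + 2)) (x i)) := by
  have htrans : ∀ t, t + 1 < n →
      ¬ (D.arrow (x t) (x (t + 1)) ∧ D.arrow (x (t + 2)) (x (t + 1))) := by
    intro t ht h
    exact hchord t ht (hcol t (t + 1) (t + 2) (by omega) (by omega) (by omega) (hne t ht) h.1 h.2)
  induction m with
  | zero => exact fun i hi _ => hchord i hi
  | succ m ih =>
    intro i hi hend h
    -- The path edge at the head of the chord either also points to that head, which gives a chord
    -- shorter by one, or starts a directed path back to the tail of the chord.
    rcases h with h | h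
    · rcases hcpl (i + m + 2) (by omega) with h' | h'
      · exact ih i (by omega) (by omega) (hcol i (i + m + 3) (i + m + 2) (by omega) (by omega)
          (by omega) (fun he => by have := hinj _ _ (by omega) (by omega) he; omega) h h')
      · exact D.acyclic _ (.head h (D.transGen_of_backward hcpl htrans (i := i) (m + 2) hi h'))
    · rcases hcpl i (by omega) with h' | h'
      · exact D.acyclic _ (.head h (D.transGen_of_forward hcpl htrans h' (m + 2) hi).2)
      · have := hcol (i + 1) i (i + m + 3) (by omega) (by omega) (by omega)
          (fun he => by have := hinj _ _ (by omega) (by omega) he; omega) h' h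
        refine ih (i + 1) (by omega) (by omega) ?_
        rwa [show i + 1 + m + 2 = i + m + 3 by omega]

end DirectedAcyclicGraph

theorem proposition2 {N : Type*} [Finite N] (G : RegressionGraph N)
    (hG : G.HasChordlessCollisionPathInFourNodes ∨ ∃ n : ℕ, 4 ≤ n ∧ G.HasChordlessCycleWithin n)
    (D : DirectedAcyclicGraph N) :
    ¬ G.MarkovEquivalent D.toRegressionGraph := by
  intro hE
  rcases hG with ⟨x, hx, -, hch⟩ | ⟨n, hn, x, ⟨hx, hclosed⟩, hv, hch⟩
  · have h₁ := D.isCollision_iff.1 ((hE.isCollision_iff (hch 0 (by omega))).1 (hx.2 0 (by omega)))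
    have h₂ := D.isCollision_iff.1 ((hE.isCollision_iff (hch 1 (by omega))).1 (hx.2 1 (by omega)))
    exact D.acyclic _ (.tail (.single h₁.2) h₂.1)
  · have hcpl {i k : N} : G.Coupled i k ↔ D.arrow i k ∨ D.arrow k i :=
      hE.coupled_iff.trans D.coupled_iff
    obtain ⟨m, rfl⟩ : ∃ m, n = m + 3 := ⟨n - 3, by omega⟩
    -- The contradictory pair is `x 0` and `x (m + 2)`: it is coupled by the closing edge of the
    -- cycle, but is not the exempt pair of path endpoints.
    refine D.not_coupled_of_chordless hx.distinct (fun t ht => hcpl.1 (hx.coupled t ht))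
      (fun t ht => (hch t ht).1) (fun t ht h => (hch t ht).2.2.2 (hcpl.2 h))
      ?_ m 0 (by omega) (by omega) ?_
    · intro r s t _ hs _ hne h h'
      by_contra hrt
      have hV : G.IsV (x r) (x s) (x t) :=
        ⟨hne, hcpl.2 (.inl h), hcpl.2 (.inr h'), fun hc => hrt (hcpl.1 hc)⟩
      -- A collision node of `G` lies in `u`, whereas `x s` lies in `v`.
      rcases ((hE.isCollision_iff hV).2 (D.isCollision_iff.2 ⟨h, h'⟩)).1 with ha | ha
      · exact G.arrow_to ha (hv s hs)
      · exact (G.dashed_within ha).2 (hv s hs)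
    · have := hcpl.1 (hx.coupled (m + 2) (by omega))
      rw [← hclosed] at this
      rw [show 0 + m + 2 = m + 2 by omega]
      exact this.symm
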